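/- Let $K\subset\mathbb{R}^n$ be a convex body, that is, a compact convex set with non-empty interior, and let $\mu$ be the measure on $\mathbb{R}^n$ given by $\mathrm{d}\mu(x)=\phi(x)\,\mathrm{d}x$, where $\phi:\mathbb{R}^n\to[0,\infty)$ is even ($\phi(-x)=\phi(x)$) and quasi-concave (all superlevel sets $\{x:\phi(x)\ge r\}$ are convex). Write $K-K=\{a-b: a,b\in K\}$, $2K=\{2a: a\in K\}$, and let $\operatorname{supp}\phi$ be the closure of $\{x:\phi(x)>0\}$. Then $$\mu(K-K)\ \ge\ \mu(2K).$$ If $\mu\neq 0$ and $\mu(K-K)=\mu(2K)$, then $A=K\cap\tfrac12\operatorname{supp}\phi$ is centrally symmetric, i.e. $A-c=-(A-c)$ for some $c\in\mathbb{R}^n$. Moreover, if $K=-K$, then $\mu(K-K)=\mu(2K)$. -/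

import Mathlib

open MeasureTheory
open scoped NNReal ENNReal Pointwise

/-- A set `A` is centrally symmetric if `A - c = -(A - c)` for some point `c`. -/
def IsCentrallySymmetric {E : Type*} [AddGroup E] (A : Set E) : Prop :=
  ∃ c : E, A - {c} = -(A - {c})

/-! Let `M r` be the closure of `{φ ≥ r}`, a symmetric closed convex set, and `C = K ∩ ½ M r`. Then
`2C = 2K ∩ M r` and `C - C ⊆ (K - K) ∩ M r`, so Brunn–Minkowski for `C` and `-C` compares the two
volumes at each level. Integrating over `r > 0` (layer cake) gives the inequality.

If equality holds, it holds at almost every level, and the equality case of Brunn–Minkowski makes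
`C` centrally symmetric. The centres lie in the compact set `K`; a limit of them as `r → 0` is a
centre of `K ∩ ½ supp φ`.

The equality case is proved through marginals. Let `D = ½(C - C)` have the volume of `C`.
Brunn–Minkowski on pairs of half-space cuts of equal volume shows that the quantile function of `⟪u,
·⟫` on `D` is the average of those on `C` and `-C`. Cauchy–Schwarz for exponential moments then goes
one way and Prékopa–Leindler with density `exp ⟪u, ·⟫` the other, so the marginals of `C` and `-C`
are translates. Comparing means identifies the shift through the centroid, and Hahn–Banach yields
symmetry. -/

/-! ### Brunn–Minkowski on the line -/

/-- With `a = max A` and `b = min B`, the translates `b + A` and `a + B` both lie in `A + B` and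
meet only at `a + b`. -/
theorem Real.volume_add_volume_le_of_isCompact {A B : Set ℝ} (hA : IsCompact A) (hB : IsCompact B)
    (hA' : A.Nonempty) (hB' : B.Nonempty) : volume A + volume B ≤ volume (A + B) := by
  obtain ⟨a, ha, haA⟩ := hA.exists_isGreatest hA'
  obtain ⟨b, hb, hbB⟩ := hB.exists_isLeast hB'
  have h1 : volume ((b +ᵥ A) ∪ (a +ᵥ B)) = volume A + volume B := by
    rw [measure_union₀' ((hA.vadd b).measurableSet.nullMeasurableSet), measure_vadd, measure_vadd]
    refine measure_mono_null (t := {a + b}) ?_ (measure_singleton _)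
    rintro x ⟨⟨y, hy, rfl⟩, ⟨z, hz, hzx⟩⟩
    have h1 := haA hy
    have h2 := hbB hz
    simp only [vadd_eq_add, Set.mem_singleton_iff] at *
    linarith
  rw [← h1]
  refine measure_mono (Set.union_subset ?_ ?_)
  · rintro x ⟨y, hy, rfl⟩
    exact ⟨y, hy, b, hb, by simp [add_comm]⟩
  · rintro x ⟨y, hy, rfl⟩
    exact ⟨a, ha, y, hy, by simp⟩

/-- The Brunn–Minkowski inequality on the real line. -/
theorem Real.volume_add_volume_le {A B C : Set ℝ} (hA : MeasurableSet A) (hB : MeasurableSet B)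
    (hA' : A.Nonempty) (hB' : B.Nonempty) (hC : A + B ⊆ C) :
    volume A + volume B ≤ volume C := by
  obtain ⟨a, ha⟩ := hA'
  obtain ⟨b, hb⟩ := hB'
  have key : ∀ K ⊆ A, IsCompact K → ∀ L ⊆ B, IsCompact L →
      volume K + volume L ≤ volume C := by
    intro K hK hKc L hL hLc
    -- Inserting `a` and `b` keeps the compact sets nonempty.
    calc volume K + volume L ≤ volume (insert a K) + volume (insert b L) := by
          gcongr <;> exact Set.subset_insert _ _
      _ ≤ volume (insert a K + insert b L) :=
          volume_add_volume_le_of_isCompact (hKc.insert a) (hLc.insert b) ⟨a, by simp⟩ ⟨b, by simp⟩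
      _ ≤ volume C := measure_mono ((Set.add_subset_add (Set.insert_subset ha hK)
          (Set.insert_subset hb hL)).trans hC)
  have key2 : ∀ L ⊆ B, IsCompact L → volume A + volume L ≤ volume C := by
    intro L hL hLc
    have : volume A ≤ volume C - volume L := by
      rw [hA.measure_eq_iSup_isCompact]
      exact iSup₂_le fun K hK ↦ iSup_le fun hKc ↦
        ENNReal.le_sub_of_add_le_right hLc.measure_lt_top.ne (key K hK hKc L hL hLc)
    calc volume A + volume L ≤ (volume C - volume L) + volume L := by gcongr
      _ = volume C := tsub_add_cancel_of_le (by simpa using key ∅ (by simp) (by simp) L hL hLc)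
  by_cases hfin : volume A = ∞
  · have := key2 ∅ (by simp) (by simp)
    simp only [hfin, measure_empty, add_zero, top_le_iff] at this
    simp [this]
  have : volume B ≤ volume C - volume A := by
    rw [hB.measure_eq_iSup_isCompact]
    exact iSup₂_le fun K hK ↦ iSup_le fun hKc ↦
      ENNReal.le_sub_of_add_le_left hfin (key2 K hK hKc)
  calc volume A + volume B ≤ volume A + (volume C - volume A) := by gcongr
    _ = volume C := add_tsub_cancel_of_le (by simpa using key2 ∅ (by simp) (by simp))

/-! ### The Prékopa–Leindler inequality -/

theorem lintegral_eq_setLIntegral_Ioo_measure_lt {α : Type*} [MeasurableSpace α] (μ : Measure α)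
    {f : α → ℝ≥0∞} (hf : Measurable f) (hf1 : ∀ x, f x ≤ 1) :
    ∫⁻ x, f x ∂μ = ∫⁻ t in Set.Ioo (0 : ℝ) 1, μ {x | ENNReal.ofReal t < f x} := by
  have h1 : ∀ x, f x ≠ ∞ := fun x ↦ ((hf1 x).trans_lt ENNReal.one_lt_top).ne
  have h2 : ∫⁻ x, f x ∂μ = ∫⁻ x, ENNReal.ofReal (f x).toReal ∂μ := by
    simp [ENNReal.ofReal_toReal, h1]
  rw [h2, lintegral_eq_lintegral_meas_lt μ (Filter.Eventually.of_forall fun x ↦ ENNReal.toReal_nonneg)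
    hf.ennreal_toReal.aemeasurable, ← Set.Ioo_union_Ici_eq_Ioi zero_lt_one,
    lintegral_union measurableSet_Ici]
  · have h3 : ∫⁻ t in Set.Ici (1 : ℝ), μ {x | t < (f x).toReal} = 0 := by
      rw [setLIntegral_congr_fun (g := fun _ ↦ 0) measurableSet_Ici]
      · simp
      · intro t ht
        have : {x | t < (f x).toReal} = ∅ := by
          ext x
          have := ENNReal.toReal_mono ENNReal.one_ne_top (hf1 x)
          simp only [ENNReal.toReal_one, Set.mem_Ici] at this ht
          simp only [Set.mem_ofPred_eq, Set.mem_empty_iff_false, iff_false, not_lt]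
          linarith
        simp [this]
    rw [h3, add_zero]
    refine setLIntegral_congr_fun measurableSet_Ioo fun t ht ↦ ?_
    congr 1
    ext x
    exact (ENNReal.ofReal_lt_iff_lt_toReal ht.1.le (h1 x)).symm
  · rw [Set.disjoint_left]
    intro x hx hx'
    exact absurd hx.2 (not_lt.2 hx')

/-- Equal suprema make the superlevel sets of `f` and `g` nonempty at exactly the same levels `t <
1`. Their half-sum lies in that of `h`, so Brunn–Minkowski applies level by level. -/
theorem lintegral_add_lintegral_le_of_iSup_eq_one {f g h : ℝ → ℝ≥0∞} (hf : Measurable f)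
    (hg : Measurable g) (hh : Measurable h) (hf1 : ⨆ x, f x = 1) (hg1 : ⨆ x, g x = 1)
    (hfgh : ∀ x y, f x * g y ≤ h ((1 / 2 : ℝ) • (x + y)) ^ 2) :
    (∫⁻ x, f x) + ∫⁻ x, g x ≤ 2 * ∫⁻ x, h x := by
  have hf2 : ∀ x, f x ≤ 1 := fun x ↦ hf1 ▸ le_iSup f x
  have hg2 : ∀ x, g x ≤ 1 := fun x ↦ hg1 ▸ le_iSup g x
  calc (∫⁻ x, f x) + ∫⁻ x, g x
      = (∫⁻ t in Set.Ioo (0 : ℝ) 1, volume {x | ENNReal.ofReal t < f x}) +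
        ∫⁻ t in Set.Ioo (0 : ℝ) 1, volume {x | ENNReal.ofReal t < g x} := by
        rw [lintegral_eq_setLIntegral_Ioo_measure_lt _ hf hf2,
          lintegral_eq_setLIntegral_Ioo_measure_lt _ hg hg2]
    _ ≤ ∫⁻ t in Set.Ioo (0 : ℝ) 1, (volume {x | ENNReal.ofReal t < f x} +
          volume {x | ENNReal.ofReal t < g x}) := le_lintegral_add _ _
    _ ≤ ∫⁻ t in Set.Ioo (0 : ℝ) 1, 2 * volume {x | ENNReal.ofReal t < min (h x) 1} := by
        refine setLIntegral_mono' measurableSet_Ioo fun t ht ↦ ?_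
        have ht1 : ENNReal.ofReal t < 1 := by simpa using ht.2
        have e1 : {x | ENNReal.ofReal t < f x}.Nonempty := by
          obtain ⟨x, hx⟩ := lt_iSup_iff.1 (hf1 ▸ ht1)
          exact ⟨x, hx⟩
        have e2 : {x | ENNReal.ofReal t < g x}.Nonempty := by
          obtain ⟨x, hx⟩ := lt_iSup_iff.1 (hg1 ▸ ht1)
          exact ⟨x, hx⟩
        have e3 : volume ((fun x ↦ (1 / 2 : ℝ) • x) ⁻¹' {x | ENNReal.ofReal t < min (h x) 1}) =
            2 * volume {x | ENNReal.ofReal t < min (h x) 1} := by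
          rw [Measure.addHaar_preimage_smul volume (by norm_num : (1 / 2 : ℝ) ≠ 0)]
          norm_num
        rw [← e3]
        refine Real.volume_add_volume_le (measurableSet_lt measurable_const hf)
          (measurableSet_lt measurable_const hg) e1 e2 ?_
        rintro _ ⟨x, hx, y, hy, rfl⟩
        refine lt_min ?_ ht1
        by_contra! hlt
        refine absurd (hfgh x y) (not_le.2 ?_)
        calc h ((1 / 2 : ℝ) • (x + y)) ^ 2 ≤ ENNReal.ofReal t ^ 2 := pow_le_pow_left' hlt 2
          _ = ENNReal.ofReal t * ENNReal.ofReal t := sq _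
          _ < f x * g y := ENNReal.mul_lt_mul hx hy
    _ = 2 * ∫⁻ x, min (h x) 1 := by
        rw [lintegral_const_mul' _ _ (by simp), ← lintegral_eq_setLIntegral_Ioo_measure_lt _
          (hh.min measurable_const) (fun x ↦ min_le_right _ _)]
    _ ≤ 2 * ∫⁻ x, h x := by
        gcongr with x
        exact min_le_left _ _

theorem ENNReal.four_mul_le_sq_add (a b : ℝ≥0∞) : 4 * (a * b) ≤ (a + b) ^ 2 := by
  by_cases ha : a = ∞
  · simp [ha]
  by_cases hb : b = ∞
  · simp [hb]
  lift a to ℝ≥0 using ha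
  lift b to ℝ≥0 using hb
  norm_cast
  have := _root_.four_mul_le_sq_add (a : ℝ) b
  rw [mul_assoc] at this
  exact_mod_cast this

/-- The Prékopa–Leindler inequality with weights `1 / 2` for the measure `μ`. -/
def SatisfiesPrekopaLeindler {E : Type*} [MeasurableSpace E] [Add E] [SMul ℝ E]
    (μ : Measure E) : Prop :=
  ∀ ⦃f g h : E → ℝ≥0∞⦄, Measurable f → Measurable g → Measurable h →
    (∀ x y, f x * g y ≤ h ((1 / 2 : ℝ) • (x + y)) ^ 2) →
    (∫⁻ x, f x ∂μ) * (∫⁻ x, g x ∂μ) ≤ (∫⁻ x, h x ∂μ) ^ 2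

theorem satisfiesPrekopaLeindler_real : SatisfiesPrekopaLeindler (volume : Measure ℝ) := by
  have bdd : ∀ {f g h : ℝ → ℝ≥0∞}, Measurable f → Measurable g → Measurable h →
      ⨆ x, f x ≠ ∞ → ⨆ x, g x ≠ ∞ →
      (∀ x y, f x * g y ≤ h ((1 / 2 : ℝ) • (x + y)) ^ 2) →
      (∫⁻ x, f x) * (∫⁻ x, g x) ≤ (∫⁻ x, h x) ^ 2 := by
    intro f g h hf hg hh hf1 hg1 hfgh
    set a := ⨆ x, f x with ha
    set b := ⨆ x, g x with hb
    by_cases ha0 : a = 0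
    · have : f = 0 := by
        ext x
        exact le_antisymm ((le_iSup f x).trans_eq ha0) bot_le
      simp [this]
    by_cases hb0 : b = 0
    · have : g = 0 := by
        ext x
        exact le_antisymm ((le_iSup g x).trans_eq hb0) bot_le
      simp [this]
    -- The geometric mean is the scale for `h` that preserves the hypothesis when `f` and `g` are
    -- divided by their suprema.
    set c := (a * b) ^ (1 / 2 : ℝ) with hc
    have hcsq : c ^ 2 = a * b := by
      rw [hc, ← ENNReal.rpow_natCast, ← ENNReal.rpow_mul]
      norm_num
    have hab : a * b ≠ ∞ := ENNReal.mul_ne_top hf1 hg1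
    have hab0 : a * b ≠ 0 := mul_ne_zero ha0 hb0
    have key := lintegral_add_lintegral_le_of_iSup_eq_one (f := fun x ↦ a⁻¹ * f x)
      (g := fun x ↦ b⁻¹ * g x) (h := fun x ↦ c⁻¹ * h x) (hf.const_mul _) (hg.const_mul _)
      (hh.const_mul _) (by rw [← ENNReal.mul_iSup, ← ha, ENNReal.inv_mul_cancel ha0 hf1])
      (by rw [← ENNReal.mul_iSup, ← hb, ENNReal.inv_mul_cancel hb0 hg1]) (by
        intro x y
        rw [mul_pow, ← ENNReal.inv_pow, hcsq, ENNReal.mul_inv (.inl ha0) (.inl hf1)]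
        calc a⁻¹ * f x * (b⁻¹ * g y) = a⁻¹ * b⁻¹ * (f x * g y) := by ring
          _ ≤ _ := by gcongr; exact hfgh x y)
    rw [lintegral_const_mul _ hf, lintegral_const_mul _ hg, lintegral_const_mul _ hh] at key
    have key2 : 4 * ((a * b)⁻¹ * ((∫⁻ x, f x) * ∫⁻ x, g x)) ≤
        4 * ((a * b)⁻¹ * (∫⁻ x, h x) ^ 2) := by
      calc 4 * ((a * b)⁻¹ * ((∫⁻ x, f x) * ∫⁻ x, g x))
          = 4 * ((a⁻¹ * ∫⁻ x, f x) * (b⁻¹ * ∫⁻ x, g x)) := by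
            rw [ENNReal.mul_inv (.inl ha0) (.inl hf1)]; ring
        _ ≤ _ := ENNReal.four_mul_le_sq_add _ _
        _ ≤ _ := pow_le_pow_left' key 2
        _ = 4 * ((c ^ 2)⁻¹ * (∫⁻ x, h x) ^ 2) := by rw [ENNReal.inv_pow]; ring
        _ = _ := by rw [hcsq]
    rwa [ENNReal.mul_le_mul_iff_right (by simp) (by simp),
      ENNReal.mul_le_mul_iff_right (by simpa using hab) (by simpa using hab0)] at key2
  intro f g h hf hg hh hfgh
  -- Unbounded `f` and `g` are truncated; this only weakens what is asked of `h`.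
  have trunc : ∀ {f : ℝ → ℝ≥0∞}, Measurable f →
      ∫⁻ x, f x = ⨆ n : ℕ, ∫⁻ x, min (f x) n := by
    intro f hf
    rw [← lintegral_iSup (fun n ↦ hf.min measurable_const)
      (fun m n hmn x ↦ min_le_min_left _ (by exact_mod_cast hmn))]
    congr 1 with x
    rw [← inf_iSup_eq, ENNReal.iSup_natCast, inf_top_eq]
  rw [trunc hf, trunc hg, ENNReal.iSup_mul]
  refine iSup_le fun n ↦ ?_
  rw [ENNReal.mul_iSup]
  refine iSup_le fun m ↦ ?_
  refine bdd (hf.min measurable_const) (hg.min measurable_const) hh ?_ ?_ ?_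
  · exact ((iSup_le fun x ↦ min_le_right _ _).trans_lt (ENNReal.natCast_lt_top n)).ne
  · exact ((iSup_le fun x ↦ min_le_right _ _).trans_lt (ENNReal.natCast_lt_top m)).ne
  · exact fun x y ↦ (mul_le_mul' (min_le_left _ _) (min_le_left _ _)).trans (hfgh x y)

/-- By the inequality for `ν` on slices, the fibre integrals satisfy the hypothesis of the
inequality for `μ`; Tonelli concludes. -/
theorem SatisfiesPrekopaLeindler.prod {E F : Type*} [MeasurableSpace E] [Add E] [SMul ℝ E]
    [MeasurableSpace F] [Add F] [SMul ℝ F] {μ : Measure E} {ν : Measure F} [SFinite ν]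
    (hμ : SatisfiesPrekopaLeindler μ) (hν : SatisfiesPrekopaLeindler ν) [SFinite μ] :
    SatisfiesPrekopaLeindler (μ.prod ν) := by
  intro f g h hf hg hh hfgh
  rw [lintegral_prod _ hf.aemeasurable, lintegral_prod _ hg.aemeasurable,
    lintegral_prod _ hh.aemeasurable]
  refine hμ hf.lintegral_prod_right' hg.lintegral_prod_right' hh.lintegral_prod_right' ?_
  intro x y
  exact hν (hf.comp measurable_prodMk_left) (hg.comp measurable_prodMk_left)
    (hh.comp measurable_prodMk_left) fun x' y' ↦ hfgh (x, x') (y, y')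

theorem SatisfiesPrekopaLeindler.of_measurePreserving {E F : Type*} [MeasurableSpace E] [Add E]
    [SMul ℝ E] [MeasurableSpace F] [Add F] [SMul ℝ F] {μ : Measure E} {ν : Measure F}
    (hμ : SatisfiesPrekopaLeindler μ) (e : E → F) (he : MeasurePreserving e μ ν)
    (hadd : ∀ x y, e ((1 / 2 : ℝ) • (x + y)) = (1 / 2 : ℝ) • (e x + e y)) :
    SatisfiesPrekopaLeindler ν := by
  intro f g h hf hg hh hfgh
  rw [← he.lintegral_comp hf, ← he.lintegral_comp hg, ← he.lintegral_comp hh]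
  refine hμ (hf.comp he.measurable) (hg.comp he.measurable) (hh.comp he.measurable) fun x y ↦ ?_
  rw [hadd]
  exact hfgh _ _

theorem satisfiesPrekopaLeindler_pi (n : ℕ) :
    SatisfiesPrekopaLeindler (volume : Measure (Fin n → ℝ)) := by
  induction n with
  | zero =>
    intro f g h hf hg hh hfgh
    rw [volume_pi, Measure.pi_of_empty _ 0]
    rw [lintegral_dirac, lintegral_dirac, lintegral_dirac]
    convert hfgh 0 0
  | succ n ih =>
    refine SatisfiesPrekopaLeindler.of_measurePreserving (satisfiesPrekopaLeindler_real.prod ih)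
      _ (volume_preserving_piFinSuccAbove (fun _ : Fin (n + 1) ↦ ℝ) 0).symm ?_
    rintro ⟨x, x'⟩ ⟨y, y'⟩
    ext i
    refine Fin.cases ?_ (fun j ↦ ?_) i <;>
      simp [MeasurableEquiv.piFinSuccAbove, Fin.insertNthEquiv, mul_add]

/-- The Prékopa–Leindler inequality on Euclidean space. -/
theorem satisfiesPrekopaLeindler_euclideanSpace (n : ℕ) :
    SatisfiesPrekopaLeindler (volume : Measure (EuclideanSpace ℝ (Fin n))) :=
  (satisfiesPrekopaLeindler_pi n).of_measurePreserving _ (PiLp.volume_preserving_toLp (Fin n))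
    fun _ _ ↦ rfl

/-! ### Quantile functions and equality in Cauchy–Schwarz -/

section Quantile

theorem continuous_measureReal_Iic (P : Measure ℝ) [IsFiniteMeasure P] [NullSingletonClass P] :
    Continuous fun s ↦ P.real (Set.Iic s) := by
  have h1 : ∀ s, P.real (Set.Iic s) = ∫ x, (Set.Iic s).indicator (fun _ ↦ (1 : ℝ)) x ∂P := by
    intro s
    rw [integral_indicator measurableSet_Iic]
    simp
  simp_rw [h1]
  refine continuous_iff_continuousAt.2 fun s₀ ↦ ?_
  refine continuousAt_of_dominated (bound := fun _ ↦ 1) (.of_forall fun s ↦ ?_)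
    (.of_forall fun s ↦ .of_forall fun x ↦ ?_) (integrable_const _) ?_
  · exact (stronglyMeasurable_const.indicator measurableSet_Iic).aestronglyMeasurable
  · by_cases hx : x ∈ Set.Iic s <;> simp [hx]
  · have : ∀ᵐ x ∂P, x ≠ s₀ := by simp [ae_iff]
    filter_upwards [this] with x hx
    rcases lt_or_gt_of_ne hx with h | h
    · refine ContinuousAt.congr (f := fun _ ↦ (1 : ℝ)) continuousAt_const ?_
      filter_upwards [lt_mem_nhds h] with s hs
      simp [Set.indicator, hs.le]
    · refine ContinuousAt.congr (f := fun _ ↦ (0 : ℝ)) continuousAt_const ?_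
      filter_upwards [gt_mem_nhds h] with s hs
      simp [Set.indicator, hs]

theorem exists_measureReal_Iic_eq (P : Measure ℝ) [IsFiniteMeasure P] [NullSingletonClass P] {t : ℝ}
    (ht : t ∈ Set.Ioo 0 (P.real Set.univ)) : ∃ s, P.real (Set.Iic s) = t := by
  refine mem_range_of_exists_le_of_exists_ge (continuous_measureReal_Iic P) ?_ ?_
  · have h := (ENNReal.tendsto_toReal (measure_ne_top P _)).comp (tendsto_measure_Ici_atBot P)
    have h2 : P.real Set.univ - t < (P Set.univ).toReal := sub_lt_self _ ht.1
    obtain ⟨s, hs⟩ := (h.eventually (lt_mem_nhds h2)).exists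
    refine ⟨s, ?_⟩
    have h3 : P.real (Set.Iic s) + P.real (Set.Ioi s) = P.real Set.univ := by
      rw [← Set.compl_Iic, measureReal_add_measureReal_compl measurableSet_Iic]
    have h4 : P.real (Set.Ioi s) = P.real (Set.Ici s) := measureReal_congr Ioi_ae_eq_Ici
    have h5 : P.real Set.univ - t < P.real (Set.Ici s) := hs
    linarith
  · have h := (ENNReal.tendsto_toReal (measure_ne_top P _)).comp (tendsto_measure_Iic_atTop P)
    obtain ⟨s, hs⟩ := (h.eventually (lt_mem_nhds (show t < (P Set.univ).toReal from ht.2))).exists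
    exact ⟨s, hs.le⟩

/-- A right inverse `w` of the distribution function `F` is automatically monotone, and `w ⁻¹' Iic
s` lies between `(0, F s)` and `(0, F s]`. -/
theorem map_eq_of_measureReal_Iic_eq (P : Measure ℝ) [IsFiniteMeasure P] {w : ℝ → ℝ}
    (hw : ∀ t ∈ Set.Ioo 0 (P.real Set.univ), P.real (Set.Iic (w t)) = t) :
    AEMeasurable w (volume.restrict (Set.Ioo 0 (P.real Set.univ))) ∧
      (volume.restrict (Set.Ioo 0 (P.real Set.univ))).map w = P := by
  have hm : MonotoneOn w (Set.Ioo 0 (P.real Set.univ)) := by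
    intro a ha b hb hab
    by_contra! hlt
    have h1 : P.real (Set.Iic (w b)) ≤ P.real (Set.Iic (w a)) :=
      measureReal_mono (Set.Iic_subset_Iic.2 hlt.le)
    rw [hw a ha, hw b hb] at h1
    rw [le_antisymm hab h1] at hlt
    exact lt_irrefl _ hlt
  have hae := aemeasurable_restrict_of_monotoneOn (μ := volume) measurableSet_Ioo hm
  refine ⟨hae, ?_⟩
  refine Measure.ext_of_Iic _ _ fun s ↦ ?_
  rw [Measure.map_apply_of_aemeasurable hae measurableSet_Iic,
    Measure.restrict_apply' measurableSet_Ioo]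
  have hs : ENNReal.ofReal (P.real (Set.Iic s)) = P (Set.Iic s) := by simp
  have hsV : P.real (Set.Iic s) ≤ P.real Set.univ := measureReal_mono (Set.subset_univ _)
  refine le_antisymm ?_ ?_
  · calc _ ≤ volume (Set.Ioc 0 (P.real (Set.Iic s))) := by
          refine measure_mono ?_
          rintro t ⟨ht1, ht2⟩
          refine ⟨ht2.1, ?_⟩
          rw [← hw t ht2]
          exact measureReal_mono (Set.Iic_subset_Iic.2 ht1)
      _ = _ := by rw [Real.volume_Ioc, sub_zero, hs]
  · calc _ = volume (Set.Ioo 0 (P.real (Set.Iic s))) := by rw [Real.volume_Ioo, sub_zero, hs]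
      _ ≤ _ := by
          refine measure_mono ?_
          rintro t ⟨ht1, ht2⟩
          have ht3 : t ∈ Set.Ioo 0 (P.real Set.univ) := ⟨ht1, ht2.trans_le hsV⟩
          refine ⟨?_, ht3⟩
          by_contra! hlt
          have : P.real (Set.Iic s) ≤ P.real (Set.Iic (w t)) :=
            measureReal_mono (Set.Iic_subset_Iic.2 (not_le.1 hlt).le)
          rw [hw t ht3] at this
          exact absurd ht2 (not_lt.2 this)

/-- If `S` is the law of the average of `P` and `Q` in the monotone coupling, then equality in the
Cauchy–Schwarz inequality for the exponential moments forces `P` to be a translate of `Q`. -/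
theorem exists_eq_map_add_of_integral_exp_mul_le (P Q S : Measure ℝ) [IsFiniteMeasure P]
    [IsFiniteMeasure Q] [IsFiniteMeasure S] [NullSingletonClass P] [NullSingletonClass Q]
    (hQ : Q.real Set.univ = P.real Set.univ) (hR : S.real Set.univ = P.real Set.univ)
    (hcut : ∀ s t, P.real (Set.Iic s) = Q.real (Set.Iic t) →
      S.real (Set.Iic ((s + t) / 2)) = P.real (Set.Iic s))
    (hPe : Integrable Real.exp P) (hQe : Integrable Real.exp Q) (hRe : Integrable Real.exp S)
    (hexp : (∫ x, Real.exp x ∂P) * (∫ x, Real.exp x ∂Q) ≤ (∫ x, Real.exp x ∂S) ^ 2) :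
    ∃ k : ℝ, P = Q.map (fun x ↦ x + k) := by
  by_cases hP0 : P = 0
  · have : Q = 0 := by
      rw [← Measure.measure_univ_eq_zero, ← measureReal_eq_zero_iff, hQ, hP0]
      simp
    exact ⟨0, by simp [hP0, this]⟩
  have hQ0 : Q ≠ 0 := by
    rw [Ne, ← Measure.measure_univ_eq_zero, ← measureReal_eq_zero_iff, hQ, measureReal_eq_zero_iff,
      Measure.measure_univ_eq_zero]
    exact hP0
  have exP : ∀ t, ∃ s, t ∈ Set.Ioo 0 (P.real Set.univ) → P.real (Set.Iic s) = t := fun t ↦ by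
    by_cases ht : t ∈ Set.Ioo 0 (P.real Set.univ)
    · obtain ⟨s, hs⟩ := exists_measureReal_Iic_eq P ht
      exact ⟨s, fun _ ↦ hs⟩
    · exact ⟨0, fun h ↦ absurd h ht⟩
  have exQ : ∀ t, ∃ s, t ∈ Set.Ioo 0 (P.real Set.univ) → Q.real (Set.Iic s) = t := fun t ↦ by
    by_cases ht : t ∈ Set.Ioo 0 (P.real Set.univ)
    · obtain ⟨s, hs⟩ := exists_measureReal_Iic_eq Q (hQ ▸ ht)
      exact ⟨s, fun _ ↦ hs⟩
    · exact ⟨0, fun h ↦ absurd h ht⟩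
  choose p hp using exP
  choose q hq using exQ
  obtain ⟨hpm, hpP⟩ := map_eq_of_measureReal_Iic_eq P hp
  obtain ⟨hqm, hqQ⟩ := map_eq_of_measureReal_Iic_eq Q (w := q) (hQ ▸ hq)
  -- `hcut` says that the average of the two quantiles is a quantile of `S`.
  obtain ⟨hrm, hrR⟩ := map_eq_of_measureReal_Iic_eq S (w := fun t ↦ (p t + q t) / 2) (by
    rw [hR]
    intro t ht
    rw [hcut _ _ ((hp t ht).trans (hq t ht).symm), hp t ht])
  rw [hQ] at hqm hqQ
  rw [hR] at hrm hrR
  set L := volume.restrict (Set.Ioo 0 (P.real Set.univ)) with hL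
  have hPi : ∫ x, Real.exp x ∂P = ∫ t, Real.exp (p t) ∂L := by
    conv_lhs => rw [← hpP]
    exact integral_map hpm Real.continuous_exp.aestronglyMeasurable
  have hQi : ∫ x, Real.exp x ∂Q = ∫ t, Real.exp (q t) ∂L := by
    conv_lhs => rw [← hqQ]
    exact integral_map hqm Real.continuous_exp.aestronglyMeasurable
  have hRi : ∫ x, Real.exp x ∂S = ∫ t, Real.exp ((p t + q t) / 2) ∂L := by
    conv_lhs => rw [← hrR]
    exact integral_map hrm Real.continuous_exp.aestronglyMeasurable
  have hPL : Integrable (fun t ↦ Real.exp (p t)) L := by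
    rw [← hpP] at hPe
    exact hPe.comp_aemeasurable hpm
  have hQL : Integrable (fun t ↦ Real.exp (q t)) L := by
    rw [← hqQ] at hQe
    exact hQe.comp_aemeasurable hqm
  have hRL : Integrable (fun t ↦ Real.exp ((p t + q t) / 2)) L := by
    rw [← hrR] at hRe
    exact hRe.comp_aemeasurable hrm
  have hA : 0 < ∫ x, Real.exp x ∂P := by
    have : NeZero P := ⟨hP0⟩
    exact integral_exp_pos hPe
  have hB : 0 < ∫ x, Real.exp x ∂Q := by
    have : NeZero Q := ⟨hQ0⟩
    exact integral_exp_pos hQe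
  set A := ∫ x, Real.exp x ∂P
  set B := ∫ x, Real.exp x ∂Q
  set I := ∫ x, Real.exp x ∂S
  have hI : 0 ≤ I := integral_nonneg fun x ↦ (Real.exp_pos x).le
  have hle : √A * √B ≤ I := by
    rw [← Real.sqrt_mul hA.le]
    exact Real.sqrt_le_iff.2 ⟨hI, hexp⟩
  -- The defect in Cauchy–Schwarz: its integral is `2AB - 2√A√B I`, which `hexp` makes nonpositive,
  -- so the square vanishes almost everywhere.
  have hsq : ∀ t, (√B * Real.exp (p t / 2) - √A * Real.exp (q t / 2)) ^ 2 =
      B * Real.exp (p t) + A * Real.exp (q t) -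
        2 * (√A * √B) * Real.exp ((p t + q t) / 2) := by
    intro t
    have e1 : Real.exp (p t) = Real.exp (p t / 2) ^ 2 := by
      rw [← Real.exp_nat_mul]; congr 1; push_cast; ring
    have e2 : Real.exp (q t) = Real.exp (q t / 2) ^ 2 := by
      rw [← Real.exp_nat_mul]; congr 1; push_cast; ring
    have e3 : Real.exp ((p t + q t) / 2) = Real.exp (p t / 2) * Real.exp (q t / 2) := by
      rw [← Real.exp_add]; congr 1; ring
    rw [e1, e2, e3, sub_sq, mul_pow, mul_pow, Real.sq_sqrt hA.le, Real.sq_sqrt hB.le]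
    ring
  have hint : Integrable
      (fun t ↦ (√B * Real.exp (p t / 2) - √A * Real.exp (q t / 2)) ^ 2) L := by
    simp_rw [hsq]
    exact ((hPL.const_mul _).add (hQL.const_mul _)).sub (hRL.const_mul _)
  have hzero : ∫ t, (√B * Real.exp (p t / 2) - √A * Real.exp (q t / 2)) ^ 2 ∂L = 0 := by
    refine le_antisymm ?_ (integral_nonneg fun t ↦ sq_nonneg _)
    simp_rw [hsq]
    have hsum : Integrable (fun t ↦ B * Real.exp (p t) + A * Real.exp (q t)) L :=
      (hPL.const_mul _).add (hQL.const_mul _)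
    rw [integral_sub hsum (hRL.const_mul _),
      integral_add (hPL.const_mul _) (hQL.const_mul _), integral_const_mul, integral_const_mul,
      integral_const_mul, ← hPi, ← hQi, ← hRi]
    have h1 : 0 ≤ √A * √B := by positivity
    have h2 : (√A * √B) * (√A * √B) = A * B := by
      rw [mul_mul_mul_comm, Real.mul_self_sqrt hA.le, Real.mul_self_sqrt hB.le]
    have h3 := mul_le_mul_of_nonneg_left hle h1
    rw [h2] at h3
    linarith
  have hae := (integral_eq_zero_iff_of_nonneg (fun t ↦ sq_nonneg _) hint).1 hzero
  refine ⟨Real.log A - Real.log B, ?_⟩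
  have hpq : p =ᵐ[L] fun t ↦ q t + (Real.log A - Real.log B) := by
    filter_upwards [hae] with t ht
    have h1 : √B * Real.exp (p t / 2) = √A * Real.exp (q t / 2) := by
      simpa [sub_eq_zero] using ht
    have h2 := congrArg Real.log h1
    rw [Real.log_mul (by positivity) (by positivity), Real.log_mul (by positivity) (by positivity),
      Real.log_exp, Real.log_exp, Real.log_sqrt hA.le, Real.log_sqrt hB.le] at h2
    linarith
  conv_lhs => rw [← hpP]
  rw [Measure.map_congr hpq]
  conv_rhs => rw [← hqQ]
  rw [AEMeasurable.map_map_of_aemeasurable (by fun_prop) hqm]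
  rfl

end Quantile

/-! ### Marginals and the equality case of Brunn–Minkowski -/

section Marginal

variable {n : ℕ}

local notation "E" => EuclideanSpace ℝ (Fin n)

theorem volume_mul_volume_le_sq {A B D : Set E} (hA : MeasurableSet A) (hB : MeasurableSet B)
    (hD : MeasurableSet D) (hABD : ∀ x ∈ A, ∀ y ∈ B, (1 / 2 : ℝ) • (x + y) ∈ D) :
    volume A * volume B ≤ volume D ^ 2 := by
  have h := satisfiesPrekopaLeindler_euclideanSpace n (f := A.indicator 1) (g := B.indicator 1)
    (h := D.indicator 1) (measurable_one.indicator hA) (measurable_one.indicator hB)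
    (measurable_one.indicator hD) (by
      intro x y
      by_cases hx : x ∈ A
      · by_cases hy : y ∈ B
        · rw [Set.indicator_of_mem hx, Set.indicator_of_mem hy,
          Set.indicator_of_mem (hABD x hx y hy)]
          exact (by norm_num : (1 : ℝ≥0∞) * 1 ≤ 1 ^ 2)
        · simp [hy]
      · simp [hx])
  simpa [lintegral_indicator_one, hA, hB, hD] using h

theorem volume_setOf_inner_eq {u : E} (hu : u ≠ 0) (s : ℝ) : volume {x : E | inner ℝ u x = s} = 0 := by
  have h1 : {x : E | inner ℝ u x = s} = (fun x ↦ x + -((s / ‖u‖ ^ 2) • u)) ⁻¹'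
      (LinearMap.ker (innerSL ℝ u).toLinearMap : Submodule ℝ E) := by
    ext x
    have : ‖u‖ ≠ 0 := norm_ne_zero_iff.2 hu
    simp only [Set.mem_ofPred_eq, Set.mem_preimage, SetLike.mem_coe, LinearMap.mem_ker,
      ContinuousLinearMap.coe_coe, innerSL_apply_apply, inner_add_right, inner_neg_right,
      inner_smul_right, real_inner_self_eq_norm_sq]
    field_simp
    constructor <;> intro h <;> linarith
  rw [h1, measure_preimage_add_right]
  refine Measure.addHaar_submodule _ _ fun h ↦ ?_
  have : u ∈ LinearMap.ker (innerSL ℝ u).toLinearMap := by rw [h]; trivial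
  simp [hu] at this

/-- The law of the linear form `x ↦ ⟪u, x⟫` on the set `A`. -/
noncomputable def marginal (u : E) (A : Set E) : Measure ℝ :=
  (volume.restrict A).map fun x ↦ inner ℝ u x

theorem measurable_inner_left_const (u : E) : Measurable fun x : E ↦ inner ℝ u x :=
  (continuous_const.inner continuous_id).measurable

theorem marginal_apply (u : E) (A : Set E) {T : Set ℝ} (hT : MeasurableSet T) :
    marginal u A T = volume ({x | inner ℝ u x ∈ T} ∩ A) := by
  rw [marginal, Measure.map_apply (measurable_inner_left_const u) hT,
    Measure.restrict_apply (measurable_inner_left_const u hT)]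
  rfl

theorem isFiniteMeasure_marginal (u : E) {A : Set E} (hA : IsCompact A) :
    IsFiniteMeasure (marginal u A) := by
  refine ⟨?_⟩
  rw [marginal_apply u A MeasurableSet.univ]
  exact (measure_mono Set.inter_subset_right).trans_lt hA.measure_lt_top

theorem nullSingletonClass_marginal {u : E} (hu : u ≠ 0) (A : Set E) :
    NullSingletonClass (marginal u A) := by
  refine ⟨fun s ↦ ?_⟩
  rw [marginal_apply u A (measurableSet_singleton s)]
  exact measure_mono_null Set.inter_subset_left (volume_setOf_inner_eq hu s)

theorem integrable_marginal (u : E) {A : Set E} (hA : IsCompact A) {f : ℝ → ℝ}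
    (hf : Continuous f) : Integrable f (marginal u A) := by
  rw [marginal, integrable_map_measure hf.aestronglyMeasurable
    (measurable_inner_left_const u).aemeasurable]
  exact ContinuousOn.integrableOn_compact hA
    (hf.comp (continuous_const.inner continuous_id)).continuousOn

theorem integral_marginal (u : E) (A : Set E) {f : ℝ → ℝ} (hf : Continuous f) :
    ∫ t, f t ∂(marginal u A) = ∫ x in A, f (inner ℝ u x) :=
  integral_map (measurable_inner_left_const u).aemeasurable hf.aestronglyMeasurable

theorem ofReal_integral_exp_marginal (u : E) {A : Set E} (hA : IsCompact A) :
    ENNReal.ofReal (∫ t, Real.exp t ∂(marginal u A)) =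
      ∫⁻ x, A.indicator (fun x ↦ ENNReal.ofReal (Real.exp (inner ℝ u x))) x := by
  rw [ofReal_integral_eq_lintegral_ofReal (integrable_marginal u hA Real.continuous_exp)
    (.of_forall fun x ↦ (Real.exp_pos x).le), marginal,
    lintegral_map (by fun_prop) (measurable_inner_left_const u), lintegral_indicator hA.measurableSet]

/-- Prékopa–Leindler for `exp ⟪u, ·⟫` restricted to each set; linearity of the exponent gives
equality at midpoints. -/
theorem integral_exp_marginal_mul_le {A B D : Set E} (hA : IsCompact A) (hB : IsCompact B)
    (hD : IsCompact D) (hABD : ∀ x ∈ A, ∀ y ∈ B, (1 / 2 : ℝ) • (x + y) ∈ D) (u : E) :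
    (∫ t, Real.exp t ∂(marginal u A)) * (∫ t, Real.exp t ∂(marginal u B)) ≤
      (∫ t, Real.exp t ∂(marginal u D)) ^ 2 := by
  have nn : ∀ S : Set E, 0 ≤ ∫ t, Real.exp t ∂(marginal u S) := fun S ↦
    integral_nonneg fun x ↦ (Real.exp_pos x).le
  rw [← ENNReal.ofReal_le_ofReal_iff (by positivity), ENNReal.ofReal_mul (nn A),
    ENNReal.ofReal_pow (nn D), ofReal_integral_exp_marginal u hA,
    ofReal_integral_exp_marginal u hB, ofReal_integral_exp_marginal u hD]
  have hm : Measurable fun x : E ↦ ENNReal.ofReal (Real.exp (inner ℝ u x)) :=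
    (Real.measurable_exp.comp (measurable_inner_left_const u)).ennreal_ofReal
  refine satisfiesPrekopaLeindler_euclideanSpace n (hm.indicator hA.measurableSet)
    (hm.indicator hB.measurableSet) (hm.indicator hD.measurableSet) fun x y ↦ ?_
  by_cases hx : x ∈ A
  · by_cases hy : y ∈ B
    · rw [Set.indicator_of_mem hx, Set.indicator_of_mem hy, Set.indicator_of_mem (hABD x hx y hy),
        ← ENNReal.ofReal_mul (Real.exp_pos _).le, ← ENNReal.ofReal_pow (Real.exp_pos _).le,
        ← Real.exp_add, ← Real.exp_nat_mul]
      refine le_of_eq ?_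
      congr 2
      rw [inner_smul_right, inner_add_right]
      push_cast
      ring
    · simp [hy]
  · simp [hx]

theorem measureReal_mul_le_sq {A B D : Set E} (hA : IsCompact A) (hB : IsCompact B)
    (hD : IsCompact D) (hABD : ∀ x ∈ A, ∀ y ∈ B, (1 / 2 : ℝ) • (x + y) ∈ D) :
    volume.real A * volume.real B ≤ volume.real D ^ 2 := by
  have h := ENNReal.toReal_mono (ENNReal.pow_ne_top hD.measure_lt_top.ne)
    (volume_mul_volume_le_sq hA.measurableSet hB.measurableSet hD.measurableSet hABD)
  rwa [ENNReal.toReal_mul, ENNReal.toReal_pow] at h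

/-- Brunn–Minkowski bounds the part of `D` on each side of the midpoint hyperplane from below. The
total volumes agree, so both bounds are equalities. -/
theorem marginal_real_Iic_midpoint {A B D : Set E} (hA : IsCompact A) (hB : IsCompact B)
    (hD : IsCompact D) (hABD : ∀ x ∈ A, ∀ y ∈ B, (1 / 2 : ℝ) • (x + y) ∈ D)
    (hBA : volume B = volume A) (hDA : volume D = volume A) {u : E} (hu : u ≠ 0) {s t : ℝ}
    (hst : (marginal u A).real (Set.Iic s) = (marginal u B).real (Set.Iic t)) :
    (marginal u D).real (Set.Iic ((s + t) / 2)) = (marginal u A).real (Set.Iic s) := by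
  have tot : ∀ {S : Set E}, IsCompact S → ∀ r : ℝ,
      (marginal u S).real (Set.Iic r) + (marginal u S).real (Set.Ici r) = volume.real S := by
    intro S hS r
    have := isFiniteMeasure_marginal u hS
    have := nullSingletonClass_marginal hu S
    rw [← measureReal_congr (μ := marginal u S) (Ioi_ae_eq_Ici (a := r)), ← Set.compl_Iic,
      measureReal_add_measureReal_compl measurableSet_Iic, measureReal_def,
      marginal_apply u S MeasurableSet.univ]
    simp [measureReal_def]
  have eqr : ∀ {S : Set E} {T : Set ℝ}, MeasurableSet T →
      (marginal u S).real T = volume.real ({x | inner ℝ u x ∈ T} ∩ S) := by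
    intro S T hT
    rw [measureReal_def, marginal_apply u S hT, measureReal_def]
  have cl : ∀ {T : Set ℝ}, IsClosed T → IsClosed {x : E | inner ℝ u x ∈ T} := fun hT ↦
    hT.preimage (continuous_const.inner continuous_id)
  have hV1 : volume.real B = volume.real A := by rw [measureReal_def, measureReal_def, hBA]
  have hV2 : volume.real D = volume.real A := by rw [measureReal_def, measureReal_def, hDA]
  have lo : (marginal u A).real (Set.Iic s) ≤ (marginal u D).real (Set.Iic ((s + t) / 2)) := by
    refine (pow_le_pow_iff_left₀ measureReal_nonneg measureReal_nonneg two_ne_zero).1 ?_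
    rw [sq]
    nth_rewrite 2 [hst]
    rw [eqr measurableSet_Iic, eqr measurableSet_Iic, eqr measurableSet_Iic]
    refine measureReal_mul_le_sq (hA.inter_left (cl isClosed_Iic)) (hB.inter_left (cl isClosed_Iic))
      (hD.inter_left (cl isClosed_Iic)) ?_
    rintro x ⟨hx1, hx2⟩ y ⟨hy1, hy2⟩
    refine ⟨?_, hABD x hx2 y hy2⟩
    simp only [Set.mem_Iic, Set.mem_ofPred_eq, inner_smul_right, inner_add_right] at *
    linarith
  have hi : (marginal u A).real (Set.Ici s) ≤ (marginal u D).real (Set.Ici ((s + t) / 2)) := by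
    have hst' : (marginal u A).real (Set.Ici s) = (marginal u B).real (Set.Ici t) := by
      linarith [tot hA s, tot hB t]
    refine (pow_le_pow_iff_left₀ measureReal_nonneg measureReal_nonneg two_ne_zero).1 ?_
    rw [sq]
    nth_rewrite 2 [hst']
    rw [eqr measurableSet_Ici, eqr measurableSet_Ici, eqr measurableSet_Ici]
    refine measureReal_mul_le_sq (hA.inter_left (cl isClosed_Ici)) (hB.inter_left (cl isClosed_Ici))
      (hD.inter_left (cl isClosed_Ici)) ?_
    rintro x ⟨hx1, hx2⟩ y ⟨hy1, hy2⟩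
    refine ⟨?_, hABD x hx2 y hy2⟩
    simp only [Set.mem_Ici, Set.mem_ofPred_eq, inner_smul_right, inner_add_right] at *
    linarith
  linarith [tot hA s, tot hD ((s + t) / 2)]

/-- In the equality case of the Brunn–Minkowski inequality, marginals agree up to translation. -/
theorem exists_marginal_eq_map_add {A B D : Set E} (hA : IsCompact A) (hB : IsCompact B)
    (hD : IsCompact D) (hABD : ∀ x ∈ A, ∀ y ∈ B, (1 / 2 : ℝ) • (x + y) ∈ D)
    (hBA : volume B = volume A) (hDA : volume D = volume A) {u : E} (hu : u ≠ 0) :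
    ∃ k : ℝ, marginal u A = (marginal u B).map (fun x ↦ x + k) := by
  have := isFiniteMeasure_marginal u hA
  have := isFiniteMeasure_marginal u hB
  have := isFiniteMeasure_marginal u hD
  have := nullSingletonClass_marginal hu A
  have := nullSingletonClass_marginal hu B
  have univ : ∀ S : Set E, (marginal u S).real Set.univ = (volume S).toReal := by
    intro S
    rw [measureReal_def, marginal_apply u S MeasurableSet.univ]
    simp
  exact exists_eq_map_add_of_integral_exp_mul_le (marginal u A) (marginal u B) (marginal u D)
    (by rw [univ, univ, hBA]) (by rw [univ, univ, hDA])
    (fun s t ↦ marginal_real_Iic_midpoint hA hB hD hABD hBA hDA hu)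
    (integrable_marginal u hA Real.continuous_exp) (integrable_marginal u hB Real.continuous_exp)
    (integrable_marginal u hD Real.continuous_exp) (integral_exp_marginal_mul_le hA hB hD hABD u)

/-- The equality case of the Brunn–Minkowski inequality for a convex body and its reflection. -/
theorem exists_two_smul_sub_mem_of_volume_eq {C : Set E} (hC : IsCompact C) (hconv : Convex ℝ C)
    (hint : (interior C).Nonempty) (hvol : volume ((1 / 2 : ℝ) • (C - C)) = volume C) :
    ∃ c : E, ∀ x ∈ C, (2 : ℝ) • c - x ∈ C := by
  have hV : 0 < volume.real C := ENNReal.toReal_pos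
    (((isOpen_interior.measure_pos volume hint).trans_le (measure_mono interior_subset)).ne')
    hC.measure_lt_top.ne
  -- The centroid is the candidate centre.
  set c : E := (volume.real C)⁻¹ • ∫ x in C, x with hc
  have hidC : IntegrableOn (fun x : E ↦ x) C := ContinuousOn.integrableOn_compact hC continuousOn_id
  have hmean : ∀ u : E, ∫ t, t ∂(marginal u C) = volume.real C * inner ℝ u c := by
    intro u
    rw [integral_marginal u C (f := fun t ↦ t) continuous_id, integral_inner hidC u, hc, inner_smul_right, mul_inv_cancel_left₀ hV.ne']
  have hneg : ∀ u : E, marginal u (-C) = (marginal u C).map Neg.neg := by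
    intro u
    ext T hT
    rw [Measure.map_apply measurable_neg hT, marginal_apply u _ hT,
      marginal_apply u _ (measurable_neg hT), ← Measure.measure_neg]
    congr 1
    ext x
    simp
  refine ⟨c, fun x hx ↦ ?_⟩
  by_contra hnot
  obtain ⟨f, s, hfs, hsf⟩ := geometric_hahn_banach_closed_point hconv hC.isClosed hnot
  set u : E := (InnerProductSpace.toDual ℝ E).symm f with hu_def
  have hf : ∀ y, f y = inner ℝ u y := fun y ↦ by
    rw [hu_def, InnerProductSpace.toDual_symm_apply]
  simp only [hf] at hfs hsf
  have hu : u ≠ 0 := by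
    intro h0
    have h1 := hfs x hx
    simp only [h0, inner_zero_left] at h1 hsf
    linarith
  obtain ⟨k, hk⟩ := exists_marginal_eq_map_add (D := (1 / 2 : ℝ) • (C - C)) hC hC.neg
    ((sub_eq_add_neg C C ▸ hC.add hC.neg : IsCompact (C - C)).smul (1 / 2 : ℝ)) (by
      intro x hx y hy
      refine Set.smul_mem_smul_set ?_
      rw [← sub_neg_eq_add]
      exact Set.sub_mem_sub hx hy) (Measure.measure_neg _ _) hvol hu
  have hkc : k = 2 * inner ℝ u c := by
    have := isFiniteMeasure_marginal u hC
    have h1 : ∫ t, t ∂(marginal u C) = - ∫ t, t ∂(marginal u C) + volume.real C * k := by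
      conv_lhs => rw [hk, hneg]
      rw [integral_map (by fun_prop) (by fun_prop), integral_map (by fun_prop) (by fun_prop),
        integral_add (integrable_marginal u hC continuous_neg) (integrable_const _),
        integral_neg, integral_const, smul_eq_mul, measureReal_def,
        marginal_apply u C MeasurableSet.univ]
      simp [measureReal_def]
    rw [hmean] at h1
    have h2 : volume.real C * (k - 2 * inner ℝ u c) = 0 := by linarith
    rcases mul_eq_zero.1 h2 with h | h
    · exact absurd h hV.ne'
    · linarith
  have hzero : marginal u C (Set.Ioi s) = 0 := by
    rw [marginal_apply u C measurableSet_Ioi]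
    convert measure_empty (μ := (volume : Measure E))
    ext y
    simp only [Set.mem_inter_iff, Set.mem_ofPred_eq, Set.mem_Ioi, Set.mem_empty_iff_false, iff_false,
      not_and]
    exact fun h1 h2 ↦ absurd (hfs y h2) (not_lt.2 h1.le)
  rw [hk, hneg, Measure.map_map (by fun_prop) measurable_neg,
    Measure.map_apply (by fun_prop) measurableSet_Ioi,
    marginal_apply u C (((by fun_prop : Measurable fun x : ℝ ↦ x + k).comp measurable_neg)
      measurableSet_Ioi)] at hzero
  -- As `k = 2⟪u, c⟫`, these are the `y` whose reflection `2c - y` lies beyond the separating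
  -- hyperplane. The set is open and contains `x ∈ C`, so it meets `C` in positive volume, against
  -- `hzero`.
  set O : Set E := {y | -inner ℝ u y + k > s} with hO
  have hOopen : IsOpen O :=
    isOpen_lt continuous_const ((continuous_const.inner continuous_id).neg.add continuous_const)
  have hxO : x ∈ O := by
    simp only [inner_sub_right, inner_smul_right] at hsf
    simp only [hO, Set.mem_ofPred_eq]
    linarith
  have hxcl : x ∈ closure (interior C) := by
    rw [hconv.closure_interior_eq_closure_of_nonempty_interior hint]
    exact subset_closure hx
  have hne : (O ∩ interior C).Nonempty := mem_closure_iff.1 hxcl O hOopen hxO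
  refine ((hOopen.inter isOpen_interior).measure_pos volume hne).ne' (measure_mono_null ?_ hzero)
  exact Set.inter_subset_inter (fun y hy ↦ hy) interior_subset

end Marginal

/-! ### Comparison at a single superlevel set -/

section Weighted

open Filter Topology

variable {n : ℕ}

local notation "E" => EuclideanSpace ℝ (Fin n)

theorem Convex.interior_nonempty_of_volume_ne_zero {S : Set E} (hS : Convex ℝ S)
    (h : volume S ≠ 0) : (interior S).Nonempty := by
  by_contra hne
  rw [Set.not_nonempty_iff_eq_empty] at hne
  refine h (measure_mono_null ?_ (hS.addHaar_frontier volume))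
  rw [frontier, hne, Set.sdiff_empty]
  exact subset_closure

/-- Multiplicative Brunn–Minkowski for `C` and `-C`, which have equal volume. -/
theorem IsCompact.volume_le_volume_half_smul_sub {C : Set E} (hC : IsCompact C) :
    volume C ≤ volume ((1 / 2 : ℝ) • (C - C)) := by
  have hD : IsCompact ((1 / 2 : ℝ) • (C - C)) :=
    (sub_eq_add_neg C C ▸ hC.add hC.neg : IsCompact (C - C)).smul (1 / 2 : ℝ)
  have h := volume_mul_volume_le_sq hC.measurableSet hC.neg.measurableSet hD.measurableSet (by
    intro x hx y hy
    refine Set.smul_mem_smul_set ?_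
    rw [← sub_neg_eq_add]
    exact Set.sub_mem_sub hx hy)
  rw [Measure.measure_neg, sq] at h
  by_contra! hlt
  exact absurd h (not_le.2 (ENNReal.mul_lt_mul hlt hlt))

theorem two_smul_inter_half_smul (K M : Set E) :
    (2 : ℝ) • (K ∩ (1 / 2 : ℝ) • M) = (2 : ℝ) • K ∩ M := by
  rw [Set.smul_set_inter₀ two_ne_zero, smul_smul]
  norm_num

theorem inter_half_smul_sub_subset {K M : Set E} (hM : Convex ℝ M) (hMneg : -M = M) :
    K ∩ (1 / 2 : ℝ) • M - K ∩ (1 / 2 : ℝ) • M ⊆ (K - K) ∩ M := by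
  rintro _ ⟨_, ⟨hx, x, hxM, rfl⟩, _, ⟨hy, y, hyM, rfl⟩, rfl⟩
  refine ⟨Set.sub_mem_sub hx hy, ?_⟩
  have hy' : -y ∈ M := by rw [← hMneg]; simpa using hyM
  have := hM hxM hy' (by norm_num : (0 : ℝ) ≤ 1 / 2) (by norm_num : (0 : ℝ) ≤ 1 / 2) (by norm_num)
  simpa [sub_eq_add_neg] using this

theorem volume_smul_eq (C : Set E) (r : ℝ) :
    volume (r • C) = ENNReal.ofReal |r ^ n| * volume C := by
  rw [Measure.addHaar_smul, finrank_euclideanSpace_fin]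

theorem volume_two_smul_inter_le {K M : Set E} (hK : IsCompact K) (hM : Convex ℝ M)
    (hMc : IsClosed M) (hMneg : -M = M) :
    volume ((2 : ℝ) • K ∩ M) ≤ volume ((K - K) ∩ M) := by
  have hC : IsCompact (K ∩ (1 / 2 : ℝ) • M) := hK.inter_right (hMc.smul₀ _)
  calc volume ((2 : ℝ) • K ∩ M)
      = volume ((2 : ℝ) • (K ∩ (1 / 2 : ℝ) • M)) := by rw [two_smul_inter_half_smul]
    _ ≤ volume ((2 : ℝ) • (1 / 2 : ℝ) • (K ∩ (1 / 2 : ℝ) • M - K ∩ (1 / 2 : ℝ) • M)) := by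
        rw [volume_smul_eq, volume_smul_eq _ 2]
        refine mul_le_mul_right ?_ _
        exact hC.volume_le_volume_half_smul_sub
    _ = volume (K ∩ (1 / 2 : ℝ) • M - K ∩ (1 / 2 : ℝ) • M) := by
        rw [smul_smul]
        norm_num
    _ ≤ _ := measure_mono (inter_half_smul_sub_subset hM hMneg)

theorem exists_center_inter_half_smul {K M : Set E} (hK : IsCompact K) (hKconv : Convex ℝ K)
    (hKint : (interior K).Nonempty) (hM : Convex ℝ M) (hMc : IsClosed M) (hMneg : -M = M)
    (hMint : (interior M).Nonempty) (heq : volume ((K - K) ∩ M) = volume ((2 : ℝ) • K ∩ M)) :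
    (interior (K ∩ (1 / 2 : ℝ) • M)).Nonempty ∧
      ∃ c ∈ K, ∀ x ∈ K ∩ (1 / 2 : ℝ) • M, (2 : ℝ) • c - x ∈ K ∩ (1 / 2 : ℝ) • M := by
  have hC : IsCompact (K ∩ (1 / 2 : ℝ) • M) := hK.inter_right (hMc.smul₀ _)
  have hCconv : Convex ℝ (K ∩ (1 / 2 : ℝ) • M) := hKconv.inter (hM.smul _)
  -- The origin is interior to both `K - K` and the symmetric set `M`.
  have hpos : volume ((K - K) ∩ M) ≠ 0 := by
    obtain ⟨k, hk⟩ := hKint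
    obtain ⟨q, hq⟩ := hMint
    have h0 : (0 : E) ∈ interior M := by
      have hq' : -q ∈ M := by rw [← hMneg]; simpa using interior_subset hq
      have := hM.combo_interior_self_mem_interior hq hq' (by norm_num : (0 : ℝ) < 1 / 2)
        (by norm_num : (0 : ℝ) ≤ 1 / 2) (by norm_num)
      simpa using this
    have hU : IsOpen ((fun x : E ↦ x + k) ⁻¹' interior K ∩ interior M) :=
      (isOpen_interior.preimage (continuous_add_const k)).inter isOpen_interior
    refine ((hU.measure_pos volume ⟨0, by simpa using hk, h0⟩).trans_le (measure_mono ?_)).ne'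
    rintro x ⟨hx1, hx2⟩
    exact ⟨⟨x + k, interior_subset hx1, k, interior_subset hk, by simp⟩, interior_subset hx2⟩
  have htwo : ENNReal.ofReal |(2 : ℝ) ^ n| ≠ 0 := by simp
  have hCpos : volume (K ∩ (1 / 2 : ℝ) • M) ≠ 0 := by
    rw [heq, ← two_smul_inter_half_smul, volume_smul_eq] at hpos
    exact right_ne_zero_of_mul hpos
  have hCint := hCconv.interior_nonempty_of_volume_ne_zero hCpos
  refine ⟨hCint, ?_⟩
  have hvol : volume ((1 / 2 : ℝ) • (K ∩ (1 / 2 : ℝ) • M - K ∩ (1 / 2 : ℝ) • M)) =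
      volume (K ∩ (1 / 2 : ℝ) • M) := by
    refine le_antisymm ?_ hC.volume_le_volume_half_smul_sub
    rw [← ENNReal.mul_le_mul_iff_right htwo ENNReal.ofReal_ne_top, ← volume_smul_eq,
      ← volume_smul_eq, two_smul_inter_half_smul, ← heq, smul_smul]
    norm_num only
    rw [one_smul]
    exact measure_mono (by simpa using inter_half_smul_sub_subset hM hMneg)
  obtain ⟨c, hc⟩ := exists_two_smul_sub_mem_of_volume_eq hC hCconv hCint hvol
  refine ⟨c, ?_, hc⟩
  obtain ⟨x, hx⟩ := hCint
  have hx := interior_subset hx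
  -- The centre is the midpoint of `x` and `2c - x`.
  have := hKconv hx.1 (hc x hx).1 (by norm_num : (0 : ℝ) ≤ 1 / 2) (by norm_num : (0 : ℝ) ≤ 1 / 2)
    (by norm_num)
  rw [smul_sub, smul_smul] at this
  simpa using this

/-! ### Integration over levels and the limit of centres -/

section Density

variable {φ : EuclideanSpace ℝ (Fin n) → ℝ≥0}

theorem QuasiconcaveOn.convex_le_coe (hφ : QuasiconcaveOn ℝ Set.univ φ) (r : ℝ) :
    Convex ℝ {x | r ≤ (φ x : ℝ)} := by
  have := hφ r.toNNReal
  simpa [Real.toNNReal_le_iff_le_coe] using this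

theorem QuasiconcaveOn.aemeasurable (hφ : QuasiconcaveOn ℝ Set.univ φ) :
    AEMeasurable φ (volume : Measure E) := by
  refine NullMeasurable.aemeasurable fun s hs ↦ ?_
  refine measurable_of_Ici (δ := NullMeasurableSpace E volume) (f := φ) (fun r ↦ ?_) hs
  have := hφ r
  simp only [Set.mem_univ, true_and] at this
  exact this.nullMeasurableSet volume

theorem QuasiconcaveOn.le_apply_zero (hφ : QuasiconcaveOn ℝ Set.univ φ) (heven : Function.Even φ)
    (x : E) : φ x ≤ φ 0 := by
  have := hφ (φ x) (show x ∈ {y | y ∈ Set.univ ∧ φ x ≤ φ y} from ⟨trivial, le_rfl⟩)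
    (show -x ∈ {y | y ∈ Set.univ ∧ φ x ≤ φ y} from ⟨trivial, (heven x).ge⟩)
    (by norm_num : (0 : ℝ) ≤ 1 / 2) (by norm_num : (0 : ℝ) ≤ 1 / 2) (by norm_num)
  simpa using this.2

/-- Layer cake; superlevel sets are convex, so their frontiers are null and closures may be taken,
which keeps the slices of `K` compact. -/
theorem withDensity_apply_eq_lintegral_superlevel (hφ : QuasiconcaveOn ℝ Set.univ φ) {S : Set E}
    (hS : MeasurableSet S) :
    (volume : Measure E).withDensity (fun x ↦ (φ x : ℝ≥0∞)) S =
      ∫⁻ r in Set.Ioi (0 : ℝ), volume (S ∩ closure {x | r ≤ (φ x : ℝ)}) := by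
  rw [withDensity_apply _ hS]
  have h1 : ∀ x, (φ x : ℝ≥0∞) = ENNReal.ofReal (φ x : ℝ) := by simp
  simp_rw [h1]
  rw [lintegral_eq_lintegral_meas_le _ (.of_forall fun x ↦ NNReal.coe_nonneg _)
    hφ.aemeasurable.restrict.coe_nnreal_real]
  congr 1 with r
  rw [Measure.restrict_apply' hS, Set.inter_comm]
  refine measure_congr ((ae_eq_refl S).inter ?_)
  exact (closure_ae_eq_of_null_frontier ((hφ.convex_le_coe r).addHaar_frontier volume)).symm

theorem neg_closure_superlevel (heven : Function.Even φ) (r : ℝ) :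
    -closure {x | r ≤ (φ x : ℝ)} = closure {x | r ≤ (φ x : ℝ)} := by
  rw [neg_closure]
  congr 1
  ext x
  simp [heven x]

theorem closure_superlevel_subset_tsupport {r : ℝ} (hr : 0 < r) :
    closure {x | r ≤ (φ x : ℝ)} ⊆ tsupport φ := by
  refine closure_mono fun x (hx : r ≤ (φ x : ℝ)) h0 ↦ ?_
  simp only [h0, NNReal.coe_zero] at hx
  linarith

theorem isCentrallySymmetric_of_two_smul_sub_mem {A : Set E} {c : E}
    (h : ∀ x ∈ A, (2 : ℝ) • c - x ∈ A) : IsCentrallySymmetric A := by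
  have key : ∀ x, x ∈ A - {c} → -x ∈ A - {c} := by
    rintro _ ⟨x, hx, _, rfl, rfl⟩
    exact ⟨_, h x hx, _, rfl, by simp only [two_smul]; abel⟩
  exact ⟨c, Set.ext fun x ↦ ⟨fun hx ↦ Set.mem_neg.2 (key x hx), fun hx ↦ by
    simpa using key _ (Set.mem_neg.1 hx)⟩⟩

/-- Moving a point slightly towards `p` stays in `K` and brings its double into the interior of `{φ
> 0}`. -/
theorem inter_half_smul_tsupport_subset_closure {K : Set E} (hK : Convex ℝ K)
    (hφ : QuasiconcaveOn ℝ Set.univ φ) {p : E} (hp : p ∈ K)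
    (hpφ : (2 : ℝ) • p ∈ interior {x | 0 < φ x}) :
    K ∩ (1 / 2 : ℝ) • tsupport φ ⊆ closure {x ∈ K | 0 < φ ((2 : ℝ) • x)} := by
  have hconv : Convex ℝ {x | 0 < φ x} := by simpa using hφ.convex_gt 0
  have hsupp : tsupport φ = closure {x | 0 < φ x} := by
    rw [tsupport]
    congr 1
    ext x
    simp [pos_iff_ne_zero]
  rintro _ ⟨hxK, x, hx, rfl⟩
  rw [hsupp] at hx
  have hlim : Tendsto (fun t : ℝ ↦ t • p + (1 - t) • (1 / 2 : ℝ) • x) (𝓝[>] 0)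
      (𝓝 ((1 / 2 : ℝ) • x)) := by
    have : Continuous fun t : ℝ ↦ t • p + (1 - t) • (1 / 2 : ℝ) • x := by fun_prop
    have h := this.tendsto 0
    simp only [zero_smul, sub_zero, one_smul, zero_add] at h
    exact h.mono_left nhdsWithin_le_nhds
  refine mem_closure_of_tendsto hlim ?_
  filter_upwards [Ioo_mem_nhdsGT (zero_lt_one' ℝ)] with t ht
  refine ⟨hK hp hxK ht.1.le (sub_nonneg.2 ht.2.le) (by ring), ?_⟩
  have h := interior_subset (hconv.combo_interior_closure_mem_interior hpφ hx ht.1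
    (sub_nonneg.2 ht.2.le) (by ring))
  have e : (2 : ℝ) • (t • p + (1 - t) • (1 / 2 : ℝ) • x) = t • (2 : ℝ) • p + (1 - t) • x := by
    module
  rw [e]
  exact h

theorem isCentrallySymmetric_of_ae_volume_eq {K : Set E} (hK : IsCompact K) (hKconv : Convex ℝ K)
    (hKint : (interior K).Nonempty) (heven : Function.Even φ)
    (hφ : QuasiconcaveOn ℝ Set.univ φ)
    (hne : (volume : Measure E).withDensity (fun x ↦ (φ x : ℝ≥0∞)) ≠ 0)
    (hae : ∀ᵐ r ∂(volume : Measure ℝ).restrict (Set.Ioi 0),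
      volume ((2 : ℝ) • K ∩ closure {x | r ≤ (φ x : ℝ)}) =
        volume ((K - K) ∩ closure {x | r ≤ (φ x : ℝ)})) :
    IsCentrallySymmetric (K ∩ (1 / 2 : ℝ) • tsupport φ) := by
  set M : ℝ → Set E := fun r ↦ closure {x | r ≤ (φ x : ℝ)} with hM
  have hMconv : ∀ r, Convex ℝ (M r) := fun r ↦ (hφ.convex_le_coe r).closure
  obtain ⟨r₀, hr₀, hr₀vol⟩ : ∃ r > 0, volume (M r) ≠ 0 := by
    by_contra! h
    refine hne (Measure.measure_univ_eq_zero.1 ?_)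
    rw [withDensity_apply_eq_lintegral_superlevel hφ MeasurableSet.univ,
      setLIntegral_congr_fun (g := fun _ ↦ 0) measurableSet_Ioi fun r hr ↦ ?_]
    · simp
    · simpa using h r hr
  have hgood : ∀ δ > 0, ∃ r, 0 < r ∧ r < δ ∧ (interior (M r)).Nonempty ∧
      (interior (K ∩ (1 / 2 : ℝ) • M r)).Nonempty ∧
      ∃ c ∈ K, ∀ x ∈ K ∩ (1 / 2 : ℝ) • M r, (2 : ℝ) • c - x ∈ K ∩ (1 / 2 : ℝ) • M r := by
    intro δ hδ
    have hm : 0 < min δ r₀ := lt_min hδ hr₀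
    -- An interval of positive length must contain a level of equality; levels below `r₀` also have
    -- `M r` of positive volume.
    have : NeBot (ae ((volume : Measure ℝ).restrict (Set.Ioo 0 (min δ r₀)))) := by
      rw [ae_neBot, Ne, Measure.restrict_eq_zero, Real.volume_Ioo]
      simpa using hm
    obtain ⟨r, hr, hreq⟩ := ((ae_restrict_mem (μ := volume)
      (measurableSet_Ioo (a := (0 : ℝ)) (b := min δ r₀))).and
      (ae_restrict_of_ae_restrict_of_subset Set.Ioo_subset_Ioi_self hae)).exists
    have hMint : (interior (M r)).Nonempty := by
      refine (hMconv r).interior_nonempty_of_volume_ne_zero fun h0 ↦ hr₀vol ?_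
      refine measure_mono_null (closure_mono fun x hx ↦ ?_) h0
      exact (hr.2.trans_le (min_le_right _ _)).le.trans hx
    exact ⟨r, hr.1, hr.2.trans_le (min_le_left _ _), hMint,
      exists_center_inter_half_smul hK hKconv hKint (hMconv r) isClosed_closure
        (neg_closure_superlevel heven r) hMint hreq.symm⟩
  choose r hr0 hrlt hMint hCint c hcK hc using fun k : ℕ ↦
    hgood (1 / ((k : ℝ) + 1)) Nat.one_div_pos_of_nat
  obtain ⟨a, -, ψ, hψ, hlim⟩ := hK.tendsto_subseq hcK
  have hr : Tendsto r atTop (𝓝 0) :=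
    squeeze_zero (fun k ↦ (hr0 k).le) (fun k ↦ (hrlt k).le) tendsto_one_div_add_atTop_nhds_zero_nat
  have hAclosed : IsClosed (K ∩ (1 / 2 : ℝ) • tsupport φ) :=
    hK.isClosed.inter ((isClosed_tsupport φ).smul₀ _)
  have hdense : ∀ x ∈ {x ∈ K | 0 < φ ((2 : ℝ) • x)},
      (2 : ℝ) • a - x ∈ K ∩ (1 / 2 : ℝ) • tsupport φ := by
    rintro x ⟨hxK, hx⟩
    have h1 : Tendsto (fun k ↦ (2 : ℝ) • (c ∘ ψ) k - x) atTop (𝓝 ((2 : ℝ) • a - x)) :=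
      (hlim.const_smul 2).sub_const x
    refine hAclosed.mem_of_tendsto h1 ?_
    -- A fixed `x` with `φ (2x) > 0` eventually belongs to the slices, where reflection in the
    -- `k`-th centre is available.
    have h2 : ∀ᶠ k in atTop, r (ψ k) < φ ((2 : ℝ) • x) :=
      (hr.comp hψ.tendsto_atTop).eventually (gt_mem_nhds (by exact_mod_cast hx))
    filter_upwards [h2] with k hk
    have h3 := hc (ψ k) x ⟨hxK, (2 : ℝ) • x, subset_closure hk.le, by simp⟩
    exact ⟨h3.1, Set.smul_set_mono (closure_superlevel_subset_tsupport (hr0 _)) h3.2⟩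
  obtain ⟨p, hp⟩ := hCint 0
  rw [interior_inter, interior_smul₀ (by norm_num)] at hp
  obtain ⟨hpK, q, hq, rfl⟩ := hp
  have hLint : (interior {x | r 0 ≤ (φ x : ℝ)}).Nonempty := by
    refine (hφ.convex_le_coe _).interior_nonempty_of_volume_ne_zero ?_
    rw [← measure_congr
      (closure_ae_eq_of_null_frontier ((hφ.convex_le_coe (r 0)).addHaar_frontier volume))]
    exact ((isOpen_interior.measure_pos volume (hMint 0)).trans_le
      (measure_mono interior_subset)).ne'
  rw [hM, (hφ.convex_le_coe (r 0)).interior_closure_eq_interior_of_nonempty_interior hLint] at hq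
  have hq' : (2 : ℝ) • (1 / 2 : ℝ) • q ∈ interior {x | 0 < φ x} := by
    rw [smul_smul]
    norm_num only
    rw [one_smul]
    refine interior_mono (fun x hx ↦ ?_) hq
    have : (0 : ℝ) < φ x := (hr0 0).trans_le hx
    exact_mod_cast this
  have hsub := inter_half_smul_tsupport_subset_closure hKconv hφ (interior_subset hpK) hq'
  refine isCentrallySymmetric_of_two_smul_sub_mem (c := a) fun x hx ↦ ?_
  have hcl : IsClosed {x | (2 : ℝ) • a - x ∈ K ∩ (1 / 2 : ℝ) • tsupport φ} :=
    hAclosed.preimage (continuous_const.sub continuous_id)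
  exact closure_minimal hdense hcl (hsub hx)

end Density

end Weighted

/-! ### The main theorem -/

theorem theoremt (n : ℕ)
    (K : ConvexBody (EuclideanSpace ℝ (Fin n)))
    (hK : (interior (K : Set (EuclideanSpace ℝ (Fin n)))).Nonempty)
    (φ : EuclideanSpace ℝ (Fin n) → ℝ≥0)
    (hφ_even : Function.Even φ)
    (hφ_quasi : QuasiconcaveOn ℝ Set.univ φ)
    (μ : Measure (EuclideanSpace ℝ (Fin n)))
    (hμ : μ = (volume : Measure (EuclideanSpace ℝ (Fin n))).withDensity
      (fun x => (φ x : ℝ≥0∞))) :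
    μ ((2 : ℝ) • (K : Set (EuclideanSpace ℝ (Fin n)))) ≤
        μ ((K : Set (EuclideanSpace ℝ (Fin n))) - (K : Set (EuclideanSpace ℝ (Fin n)))) ∧
      (μ ≠ 0 →
        μ ((K : Set (EuclideanSpace ℝ (Fin n))) - (K : Set (EuclideanSpace ℝ (Fin n)))) =
          μ ((2 : ℝ) • (K : Set (EuclideanSpace ℝ (Fin n)))) →
        IsCentrallySymmetric
          ((K : Set (EuclideanSpace ℝ (Fin n))) ∩ (1 / 2 : ℝ) • tsupport φ)) ∧
      (-(K : Set (EuclideanSpace ℝ (Fin n))) = (K : Set (EuclideanSpace ℝ (Fin n))) →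
        μ ((K : Set (EuclideanSpace ℝ (Fin n))) - (K : Set (EuclideanSpace ℝ (Fin n)))) =
          μ ((2 : ℝ) • (K : Set (EuclideanSpace ℝ (Fin n))))) := by
  have hKc := K.isCompact
  have hDc : IsCompact ((K : Set (EuclideanSpace ℝ (Fin n))) - (K : Set (EuclideanSpace ℝ (Fin n)))) :=
    sub_eq_add_neg (K : Set (EuclideanSpace ℝ (Fin n))) K ▸ hKc.add hKc.neg
  have h2c : IsCompact ((2 : ℝ) • (K : Set (EuclideanSpace ℝ (Fin n)))) := hKc.smul 2
  have hle : ∀ r : ℝ, volume ((2 : ℝ) • (K : Set (EuclideanSpace ℝ (Fin n))) ∩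
      closure {x | r ≤ (φ x : ℝ)}) ≤ volume (((K : Set (EuclideanSpace ℝ (Fin n))) - (K : Set (EuclideanSpace ℝ (Fin n)))) ∩
        closure {x | r ≤ (φ x : ℝ)}) := fun r ↦
    volume_two_smul_inter_le hKc (hφ_quasi.convex_le_coe r).closure isClosed_closure
      (neg_closure_superlevel hφ_even r)
  subst hμ
  refine ⟨?_, fun hne heq ↦ ?_, fun hneg ↦ ?_⟩
  · rw [withDensity_apply_eq_lintegral_superlevel hφ_quasi h2c.measurableSet,
      withDensity_apply_eq_lintegral_superlevel hφ_quasi hDc.measurableSet]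
    exact lintegral_mono hle
  · refine isCentrallySymmetric_of_ae_volume_eq hKc K.convex hK hφ_even hφ_quasi hne ?_
    -- Finiteness, from `φ ≤ φ 0`, lets equal integrals of ordered functions force equality almost
    -- everywhere.
    have hfin : (volume : Measure (EuclideanSpace ℝ (Fin n))).withDensity
        (fun x ↦ (φ x : ℝ≥0∞)) ((2 : ℝ) • (K : Set (EuclideanSpace ℝ (Fin n)))) ≠ ∞ := by
      rw [withDensity_apply _ h2c.measurableSet]
      refine ((lintegral_mono (g := fun _ ↦ (φ 0 : ℝ≥0∞)) fun x ↦ ?_).trans_lt ?_).ne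
      · exact ENNReal.coe_le_coe.2 <| hφ_quasi.le_apply_zero hφ_even x
      · rw [setLIntegral_const]
        exact ENNReal.mul_lt_top ENNReal.coe_lt_top h2c.measure_lt_top
    rw [withDensity_apply_eq_lintegral_superlevel hφ_quasi h2c.measurableSet] at hfin heq
    rw [withDensity_apply_eq_lintegral_superlevel hφ_quasi hDc.measurableSet] at heq
    refine ae_eq_of_ae_le_of_lintegral_le (.of_forall hle) hfin ?_ heq.le
    refine (Antitone.measurable fun r s hrs ↦ ?_).aemeasurable
    exact measure_mono (Set.inter_subset_inter_right _ (closure_mono fun x hx ↦ hrs.trans hx))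
  -- By convexity `K + K = 2K`, and symmetry turns `K - K` into `K + K`.
  · have h := K.convex.add_smul (zero_le_one' ℝ) (zero_le_one' ℝ)
    rw [one_add_one_eq_two, one_smul] at h
    rw [h, sub_eq_add_neg, hneg]
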